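/- **Model.** Let $n\ge 2$, $0\le t\le n-1$ and $1\le k\le d$ be integers. There are $n$ processes with a common clock $0,1,2,\dots$; round $m+1$ takes place between times $m$ and $m+1$. Process $i$ starts with an input value $v_i\in\{0,1,\dots,d\}$ (the basic case is $d=k$). In a *crash-failure pattern* each process either never crashes (it is *correct*) or crashes in some round $r\ge1$: its messages sent in rounds before $r$ are all delivered, those sent in round $r$ are delivered to an arbitrary set of processes, and none are sent later. A process is *active* at time $m$ if it has not crashed in rounds $1,\dots,m$. An *adversary* is a pair of an input vector in $\{0,\dots,d\}^n$ and a crash-failure pattern; the *context* $\gamma$ consists of all adversaries with at most $t$ crashing processes. A (deterministic) *protocol* prescribes, as a function of the identity of a process, the time, and its local state, the messages that it sends in the next round and the decision (if any) that it takes, and it updates the local state by the messages received. A process decides at most once, at the first time, while active, at which a decision is prescribed. A protocol *solves nonuniform $k$-set consensus* in $\gamma$ if against every adversary in $\gamma$: (k-Agreement) the correct processes decide on at most $k$ different values in total; (Decision) every correct process decides; (Validity) every value decided on by any process is the input of some process. A protocol $Q$ *dominates* $P$ in $\gamma$ if, for every adversary in $\gamma$ and every process $i$, if $i$ decides at time $m$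 in $P$, then $i$ decides at some time $m'\le m$ in $Q$; it *strictly dominates* $P$ if moreover $P$ does not dominate $Q$. A protocol $P$ is *unbeatable* if it solves nonuniform $k$-set consensus in $\gamma$ and no protocol that solves it in $\gamma$ strictly dominates $P$. **The protocol $\mathrm{Opt}_{\min[k]}$.** It is a full-information protocol: in every round every process sends its entire view to all processes. The view of $i$ at time $m$ is the labelled graph consisting of the nodes $(j,\ell)$ (process $j$ at time $\ell$) that it has *seen*, i.e. from which there is a chain of delivered messages to $(i,m)$ (a process always sees its own past), of the edges between these nodes corresponding to the delivered messages, and of the input values of the processes $j$ with $(j,0)$ seen. A node $(j,\ell)$ is *guaranteed crashed* at $(i,m)$ if some node $(h,\ell')$ with $1\le\ell'\le\ell$ that is seen by $(i,m)$ received no message from $j$ in round $\ell'$. It is *hidden* from $(i,m)$ if it is neither seen by nor guaranteed crashed at $(i,m)$. The *hidden capacity* of $(i,m)$ is the largest $c$ such that for every $\ell\le m$ at least $c$ distinct nodes at time $\ell$ are hidden from $(i,m)$. Let $\mathrm{Min}(i,m)$ be the smallest input value that $i$ has seen by time $m$; $i$ is *low* at time $m$ if $\mathrm{Min}(i,m)<k$.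 In $\mathrm{Opt}_{\min[k]}$ an undecided process $i$ at time $m$ decides on $\mathrm{Min}(i,m)$ if it is low at time $m$ or its hidden capacity at time $m$ is smaller than $k$; otherwise it does not decide at time $m$. **Theorem.** For all $n\ge2$, $0\le t\le n-1$ and $1\le k\le d$, the protocol $\mathrm{Opt}_{\min[k]}$ is an unbeatable protocol for nonuniform $k$-set consensus in the synchronous crash-failure model: it solves nonuniform $k$-set consensus in $\gamma$, and no protocol that solves nonuniform $k$-set consensus in $\gamma$ strictly dominates it. -/

import Mathlib

universe u v

namespace SetConsensus

/-! ### Failure patterns and adversaries -/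

/-- A crash-failure pattern on the processes `Fin n`. Process `i` crashes in round
`crashRound i ≥ 1` (`⊤` if it never crashes); in that round its messages reach exactly the
processes in `reach i`. Round `m + 1` takes place between time `m` and time `m + 1`. -/
structure FailurePattern (n : ℕ) where
  crashRound : Fin n → ℕ∞
  one_le_crashRound : ∀ i, 1 ≤ crashRound i
  reach : Fin n → Set (Fin n)

namespace FailurePattern

variable {n : ℕ}

/-- A message sent by `i` to `j` in round `m` is delivered: all messages in the rounds before
the crashing round, those to `reach i` in the crashing round, and none afterwards. -/
def Edge (F : FailurePattern n) (m : ℕ) (i j : Fin n) : Prop :=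
  (m : ℕ∞) < F.crashRound i ∨ ((m : ℕ∞) = F.crashRound i ∧ j ∈ F.reach i)

/-- `i` has not crashed in any of the rounds `1, …, m`. -/
def Active (F : FailurePattern n) (i : Fin n) (m : ℕ) : Prop :=
  (m : ℕ∞) < F.crashRound i

/-- `i` never crashes. -/
def Correct (F : FailurePattern n) (i : Fin n) : Prop :=
  F.crashRound i = ⊤

end FailurePattern

/-- An adversary: an input vector with values in `{0, …, d}` and a failure pattern. -/
structure Adversary (n d : ℕ) where
  input : Fin n → Fin (d + 1)
  pattern : FailurePattern n

/-- The context in which all input vectors over `{0, …, d}` are possible, and at most `t`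
processes crash. -/
def crashContext (n d t : ℕ) : Set (Adversary n d) :=
  {α | {i | ¬ α.pattern.Correct i}.ncard ≤ t}

/-! ### Protocols and their runs -/

/-- A deterministic synchronous message-passing protocol for processes `Fin n` with inputs and
decisions in `{0, …, d}`. Every process knows its identity and the global time.
At time `m` process `i` in local state `s` takes the decision `decide i m s` (if any) and sends
the message `send i m s j` (if any) to `j`; `receive i m s inbox` is its state at time `m + 1`
after receiving in round `m + 1` the messages in `inbox`. -/
structure Protocol (n d : ℕ) where
  State : Type u
  Msg : Type u
  init : Fin n → Fin (d + 1) → State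
  send : Fin n → ℕ → State → Fin n → Option Msg
  receive : Fin n → ℕ → State → (Fin n → Option Msg) → State
  decide : Fin n → ℕ → State → Option (Fin (d + 1))

namespace Protocol

variable {n d : ℕ}

open Classical in
/-- The local state of each process at time `m` in the run of `P` against `α`. (The values at
times at which the process is no longer active are never used: such a process sends nothing
and decides nothing.) -/
noncomputable def state (P : Protocol.{u} n d) (α : Adversary n d) : ℕ → Fin n → P.State
  | 0, i => P.init i (α.input i)
  | m + 1, i => P.receive i m (P.state α m i) fun j =>
      if α.pattern.Edge (m + 1) j i then P.send j m (P.state α m j) i else none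

/-- In the run of `P` against `α`, process `i` decides on `x` at time `m`: it is active, the
protocol prescribes a decision on `x`, and `i` is still undecided. -/
def DecidesAt (P : Protocol.{u} n d) (α : Adversary n d) (i : Fin n) (m : ℕ)
    (x : Fin (d + 1)) : Prop :=
  α.pattern.Active i m ∧ P.decide i m (P.state α m i) = some x ∧
    ∀ m' < m, P.decide i m' (P.state α m' i) = none

/-- The values decided on by correct processes number at most `k`. -/
def Agreement (k : ℕ) (P : Protocol.{u} n d) (α : Adversary n d) : Prop :=
  {x | ∃ i m, α.pattern.Correct i ∧ P.DecidesAt α i m x}.ncard ≤ k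

/-- Every correct process decides. -/
def Decision (P : Protocol.{u} n d) (α : Adversary n d) : Prop :=
  ∀ i, α.pattern.Correct i → ∃ m x, P.DecidesAt α i m x

/-- A value decided on by any process, correct or not, is some process's input. -/
def Validity (P : Protocol.{u} n d) (α : Adversary n d) : Prop :=
  ∀ i m x, P.DecidesAt α i m x → ∃ j, α.input j = x

/-- `P` solves (nonuniform) `k`-set consensus in the context `γ`. -/
def SolvesSetConsensus (k : ℕ) (γ : Set (Adversary n d)) (P : Protocol.{u} n d) : Prop :=
  ∀ α ∈ γ, P.Agreement k α ∧ P.Decision α ∧ P.Validity α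

/-- `Q` dominates `P` in `γ`: whenever a process decides in `P` at time `m`, then against the
same adversary it decides in `Q` at some time `m' ≤ m`. -/
def Dominates (γ : Set (Adversary n d)) (Q : Protocol.{u} n d) (P : Protocol.{v} n d) : Prop :=
  ∀ α ∈ γ, ∀ i m x, P.DecidesAt α i m x → ∃ m' ≤ m, ∃ y, Q.DecidesAt α i m' y

def StrictlyDominates (γ : Set (Adversary n d)) (Q : Protocol.{u} n d)
    (P : Protocol.{v} n d) : Prop :=
  Dominates γ Q P ∧ ¬ Dominates γ P Q

/-- `P` is an unbeatable solution to nonuniform `k`-set consensus in `γ`. -/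
def IsUnbeatable (k : ℕ) (γ : Set (Adversary n d)) (P : Protocol.{v} n d) : Prop :=
  P.SolvesSetConsensus k γ ∧
    ∀ Q : Protocol.{u} n d, Q.SolvesSetConsensus k γ → ¬ StrictlyDominates γ Q P

end Protocol

/-! ### Views and hidden capacity -/

/-- A node `(i, m)`: process `i` at time `m`. -/
abbrev Node (n : ℕ) := Fin n × ℕ

/-- A communication graph: nodes, edges, and the labels `(j, x)` recording that the initial
node `(j, 0)` is labelled with the input value `x`. -/
structure View (n d : ℕ) where
  nodes : Set (Node n)
  edges : Set (Node n × Node n)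
  labels : Set (Fin n × Fin (d + 1))

namespace View

variable {n d : ℕ}

/-- The view of `i` with input `x` at time `0`. -/
def initial (i : Fin n) (x : Fin (d + 1)) : View n d where
  nodes := {(i, 0)}
  edges := ∅
  labels := {(i, x)}

/-- The view at `(i, m + 1)` of a process with view `G` at time `m` that receives in round
`m + 1` the views in `inbox`: the union of `G` and the received views, together with the node
`(i, m + 1)` and the edges to it from `(i, m)` and from the senders of the received views. -/
def extend (i : Fin n) (m : ℕ) (G : View n d) (inbox : Fin n → Option (View n d)) :
    View n d where
  nodes := {(i, m + 1)} ∪ G.nodes ∪ {p | ∃ j H, inbox j = some H ∧ p ∈ H.nodes}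
  edges := {e | ∃ j, (j = i ∨ (inbox j).isSome) ∧ e = ((j, m), (i, m + 1))} ∪ G.edges ∪
    {e | ∃ j H, inbox j = some H ∧ e ∈ H.edges}
  labels := G.labels ∪ {l | ∃ j H, inbox j = some H ∧ l ∈ H.labels}

/-- The node `(j, l)` is seen. -/
def Seen (G : View n d) (j : Fin n) (l : ℕ) : Prop := (j, l) ∈ G.nodes

/-- The view contains a proof that `j` crashed before time `l`: some seen node `(h, r + 1)` did
not hear from `j` in round `r + 1 ≤ l`. -/
def GuaranteedCrashed (G : View n d) (j : Fin n) (l : ℕ) : Prop :=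
  ∃ h r, r + 1 ≤ l ∧ G.Seen h (r + 1) ∧ ((j, r), (h, r + 1)) ∉ G.edges

/-- The node `(j, l)` is hidden: neither seen nor guaranteed crashed. -/
def Hidden (G : View n d) (j : Fin n) (l : ℕ) : Prop :=
  ¬ G.Seen j l ∧ ¬ G.GuaranteedCrashed j l

/-- The hidden capacity of a process with view `G` at time `m`: the maximal `c` such that at
every time `l ≤ m` there are `c` distinct hidden nodes. (The supremum is of a set of natural
numbers that contains `0` and is bounded by `n`, hence a maximum.) -/
noncomputable def hiddenCapacity (G : View n d) (m : ℕ) : ℕ :=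
  sSup {c | ∀ l ≤ m, ∃ W : Finset (Fin n), W.card = c ∧ ∀ j ∈ W, G.Hidden j l}

/-- The minimal input value that has been seen. -/
noncomputable def minVal (G : View n d) : Fin (d + 1) :=
  sInf {x | ∃ j, (j, x) ∈ G.labels}

/-- The view is low: some value smaller than `k` has been seen. -/
def Low (k : ℕ) (G : View n d) : Prop := (G.minVal : ℕ) < k

end View

/-! ### The protocol -/

/-- The full-information protocol with the given decision rule: every process sends its whole
view to all processes in every round. -/
def fullInformation {n d : ℕ} (rule : Fin n → ℕ → View n d → Option (Fin (d + 1))) :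
    Protocol.{0} n d where
  State := View n d
  Msg := View n d
  init := View.initial
  send := fun _ _ G _ => some G
  receive := View.extend
  decide := rule

open Classical in
/-- The protocol `Opt_min[k]`: an undecided process decides on the minimal value it has seen as
soon as it is low or its hidden capacity is smaller than `k`. -/
noncomputable def optMin (n d k : ℕ) : Protocol.{0} n d :=
  fullInformation fun _ m G =>
    if G.Low k ∨ G.hiddenCapacity m < k then some G.minVal else none

end SetConsensus

/-! Agreement: let a correct `i` decide, at time `m`, the largest value decided by correct
processes. If `i` is low, all decided values are below `k`. Otherwise at some time `l ≤ m` fewer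
than `k` nodes are hidden from `i`. Each other decided value `x` is unseen by `i` at time `m`, yet
it passed at time `l` through a process still active then, whose minimum is `x`. That node is hidden
from `i`, and distinct values give distinct nodes, so there are fewer than `k` other values.
Decision holds because a process is hidden at one time at most, which forces hidden capacity `0` at
time `n`.

Unbeatability: let `Q` be a solution dominating `optMin`. By `low_or_hiddenCapacity_lt`, no process
decides in `Q` before it meets the condition of `optMin`, so `optMin` dominates `Q`. Otherwise `i`
decides at time `m` while high and with `k` hidden nodes at every time up to `m`. Arrange these in
`k` disjoint chains (`exists_chains`), each member crashing after reaching only its successor; `i`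
cannot tell (`state_eq_adversary`). If chain `b` carries the input `b < k`, its last member decides
`b` in `Q` (`Chains.decidesAt_node`). This uses up all `k` values, so the value of `i` is low as
well; but `i` decides the same when no low input exists, against validity.

The core is `Chains.decidesAt_node`, by induction on the length of the chains. If a process hearing
only chain `b` did not decide `b`, a greedy descent through sets of chains (`exists_rainbow_chain`)
would yield an adversary with more than `k` decided values. -/

namespace SetConsensus

/-! ### Crashes and delivery -/

namespace FailurePattern

variable {n : ℕ} {F : FailurePattern n} {i j : Fin n} {m s : ℕ}

theorem Active.mono (h : F.Active i m) (hs : s ≤ m) : F.Active i s :=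
  lt_of_le_of_lt (Nat.cast_le.2 hs) h

theorem Active.edge (h : F.Active i m) (hs : s ≤ m) : F.Edge s i j :=
  Or.inl (h.mono hs)

theorem Edge.active (h : F.Edge (m + 1) i j) : F.Active i m := by
  have h1 : (m : ℕ∞) < ((m + 1 : ℕ) : ℕ∞) := Nat.cast_lt.2 m.lt_succ_self
  rcases h with h | h
  · exact h1.trans h
  · exact h1.trans_eq h.1

theorem Correct.active (h : F.Correct i) (m : ℕ) : F.Active i m := by
  unfold Active
  rw [show F.crashRound i = ⊤ from h]
  exact ENat.natCast_lt_top m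

end FailurePattern

/-! ### Full-information views and hidden nodes -/

section Views

variable {n d : ℕ} {α : Adversary n d} {i j h q : Fin n} {m s l : ℕ}

open Classical in
/-- The view of each process at time `m` in a full-information protocol. -/
noncomputable def view (α : Adversary n d) : ℕ → Fin n → View n d
  | 0, i => View.initial i (α.input i)
  | m + 1, i => View.extend i m (view α m i) fun j =>
      if α.pattern.Edge (m + 1) j i then some (view α m j) else none

theorem state_fullInformation (rule : Fin n → ℕ → View n d → Option (Fin (d + 1)))
    (α : Adversary n d) (m : ℕ) (i : Fin n) :
    (fullInformation rule).state α m i = view α m i := by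
  induction m generalizing i with
  | zero => rfl
  | succ m ih =>
    simp only [Protocol.state, view, ih]
    rfl

theorem mem_nodes_view_succ {p : Node n} :
    p ∈ (view α (m + 1) i).nodes ↔ p = (i, m + 1) ∨ p ∈ (view α m i).nodes ∨
      ∃ j, α.pattern.Edge (m + 1) j i ∧ p ∈ (view α m j).nodes := by
  simp only [view, View.extend, Set.mem_union, Set.mem_singleton_iff, Set.mem_ofPred_eq, or_assoc]
  refine or_congr Iff.rfl (or_congr Iff.rfl (exists_congr fun j => ?_))
  by_cases hE : α.pattern.Edge (m + 1) j i <;> simp [hE]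

theorem mem_labels_view_succ {p : Fin n × Fin (d + 1)} :
    p ∈ (view α (m + 1) i).labels ↔ p ∈ (view α m i).labels ∨
      ∃ j, α.pattern.Edge (m + 1) j i ∧ p ∈ (view α m j).labels := by
  simp only [view, View.extend, Set.mem_union, Set.mem_ofPred_eq]
  refine or_congr Iff.rfl (exists_congr fun j => ?_)
  by_cases hE : α.pattern.Edge (m + 1) j i <;> simp [hE]

theorem mem_edges_view_succ {e : Node n × Node n} :
    e ∈ (view α (m + 1) i).edges ↔
      (∃ j, (j = i ∨ α.pattern.Edge (m + 1) j i) ∧ e = ((j, m), (i, m + 1))) ∨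
      e ∈ (view α m i).edges ∨
      ∃ j, α.pattern.Edge (m + 1) j i ∧ e ∈ (view α m j).edges := by
  simp only [view, View.extend, Set.mem_union, Set.mem_ofPred_eq, or_assoc]
  refine or_congr (exists_congr fun j => ?_) (or_congr Iff.rfl (exists_congr fun j => ?_))
  all_goals by_cases hE : α.pattern.Edge (m + 1) j i <;> simp [hE]

theorem self_mem_nodes_view (α : Adversary n d) (i : Fin n) (m : ℕ) :
    (i, m) ∈ (view α m i).nodes := by
  cases m with
  | zero => simp [view, View.initial]
  | succ m => exact mem_nodes_view_succ.2 (Or.inl rfl)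

theorem le_of_mem_nodes_view (hp : (j, s) ∈ (view α m i).nodes) : s ≤ m := by
  induction m generalizing i with
  | zero => simp_all [view, View.initial]
  | succ m ih =>
    rcases mem_nodes_view_succ.1 hp with h | h | ⟨j, -, h⟩
    · simp_all
    · exact (ih h).trans m.le_succ
    · exact (ih h).trans m.le_succ

theorem mem_nodes_view_of_succ (hp : (h, s + 1) ∈ (view α m i).nodes)
    (hj : j = h ∨ α.pattern.Edge (s + 1) j h) : (j, s) ∈ (view α m i).nodes := by
  induction m generalizing i with
  | zero => simp_all [view, View.initial]
  | succ m ih =>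
    rw [mem_nodes_view_succ] at hp ⊢
    rcases hp with hp | hp | ⟨j', hE, hp⟩
    · obtain ⟨rfl, hs⟩ := Prod.mk.injEq .. ▸ hp
      obtain rfl : s = m := by omega
      rcases hj with rfl | hj
      · exact Or.inr (Or.inl (self_mem_nodes_view α _ _))
      · exact Or.inr (Or.inr ⟨j, hj, self_mem_nodes_view α _ _⟩)
    · exact Or.inr (Or.inl (ih hp))
    · exact Or.inr (Or.inr ⟨j', hE, ih hp⟩)

theorem mem_nodes_view_of_le (hp : (h, m) ∈ (view α l i).nodes) (hs : s ≤ m) :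
    (h, s) ∈ (view α l i).nodes := by
  induction hs with
  | refl => exact hp
  | step _ ih => exact ih (mem_nodes_view_of_succ hp (Or.inl rfl))

theorem eq_or_edge_of_mem_edges_view (he : ((j, s), (h, s + 1)) ∈ (view α m i).edges) :
    j = h ∨ α.pattern.Edge (s + 1) j h := by
  induction m generalizing i with
  | zero => simp_all [view, View.initial]
  | succ m ih =>
    rcases mem_edges_view_succ.1 he with ⟨j', hj, h⟩ | h | ⟨j', -, h⟩
    · simp only [Prod.mk.injEq] at h
      obtain ⟨⟨rfl, rfl⟩, rfl, -⟩ := h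
      exact hj
    · exact ih h
    · exact ih h

theorem mem_edges_view (hp : (h, s + 1) ∈ (view α m i).nodes)
    (hj : j = h ∨ α.pattern.Edge (s + 1) j h) : ((j, s), (h, s + 1)) ∈ (view α m i).edges := by
  induction m generalizing i with
  | zero => simp_all [view, View.initial]
  | succ m ih =>
    rw [mem_edges_view_succ]
    rcases mem_nodes_view_succ.1 hp with hp | hp | ⟨j', hE, hp⟩
    · obtain ⟨rfl, hs⟩ := Prod.mk.injEq .. ▸ hp
      obtain rfl : s = m := by omega
      exact Or.inl ⟨j, hj, rfl⟩
    · exact Or.inr (Or.inl (ih hp))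
    · exact Or.inr (Or.inr ⟨j', hE, ih hp⟩)

theorem self_mem_labels_view (α : Adversary n d) (i : Fin n) (m : ℕ) :
    (i, α.input i) ∈ (view α m i).labels := by
  induction m with
  | zero => simp [view, View.initial]
  | succ m ih => exact mem_labels_view_succ.2 (Or.inl ih)

theorem mem_labels_view_iff {x : Fin (d + 1)} :
    (j, x) ∈ (view α m i).labels ↔ (j, 0) ∈ (view α m i).nodes ∧ x = α.input j := by
  induction m generalizing i with
  | zero => simp +contextual [view, View.initial]
  | succ m ih =>
    rw [mem_labels_view_succ, mem_nodes_view_succ]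
    simp only [ih, Prod.mk.injEq, Nat.right_eq_add, Nat.add_eq_zero_iff, one_ne_zero, and_false,
      false_or, or_and_right, ← exists_and_right, and_assoc]

theorem labels_view_subset (hp : (q, l) ∈ (view α m i).nodes) :
    (view α l q).labels ⊆ (view α m i).labels := by
  induction m generalizing i with
  | zero =>
    obtain ⟨rfl, rfl⟩ : q = i ∧ l = 0 := by simpa [view, View.initial] using hp
    exact subset_rfl
  | succ m ih =>
    rcases mem_nodes_view_succ.1 hp with hp | hp | ⟨j', hE, hp⟩
    · obtain ⟨rfl, rfl⟩ := Prod.mk.injEq .. ▸ hp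
      exact subset_rfl
    · exact fun x hx => mem_labels_view_succ.2 (Or.inl (ih hp hx))
    · exact fun x hx => mem_labels_view_succ.2 (Or.inr ⟨j', hE, ih hp hx⟩)

theorem self_mem_nodes_view_of_le (hl : l ≤ m) : (i, l) ∈ (view α m i).nodes :=
  mem_nodes_view_of_le (self_mem_nodes_view α i m) hl

/-- Every label that has reached an active process passed at each earlier time through some
process that was then active. -/
theorem exists_active_of_mem_labels_view {x : Fin n × Fin (d + 1)} (hl : l ≤ m)
    (hj : α.pattern.Active j m) (hx : x ∈ (view α m j).labels) :
    ∃ q, α.pattern.Active q l ∧ x ∈ (view α l q).labels ∧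
      (view α l q).labels ⊆ (view α m j).labels := by
  induction hl generalizing j with
  | refl => exact ⟨j, hj, hx, subset_rfl⟩
  | @step m hl ih =>
    rcases mem_labels_view_succ.1 hx with hx | ⟨j', hE, hx⟩
    · obtain ⟨q, h1, h2, h3⟩ := ih (hj.mono m.le_succ) hx
      exact ⟨q, h1, h2, fun y hy => mem_labels_view_succ.2 (Or.inl (h3 hy))⟩
    · obtain ⟨q, h1, h2, h3⟩ := ih hE.active hx
      exact ⟨q, h1, h2, fun y hy => mem_labels_view_succ.2 (Or.inr ⟨j', hE, h3 hy⟩)⟩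

theorem not_guaranteedCrashed_of_active (hq : α.pattern.Active q l) :
    ¬ (view α m i).GuaranteedCrashed q l := by
  rintro ⟨h, r, hr, hs, he⟩
  exact he (mem_edges_view hs (Or.inr (hq.edge hr)))

theorem not_edge_of_hidden (hj : (view α m i).Hidden j l) (hl : l < m) :
    ¬ α.pattern.Edge (l + 1) j i := fun hE =>
  hj.1 (mem_nodes_view_of_succ (self_mem_nodes_view_of_le hl) (Or.inr hE))

theorem ne_of_hidden (hj : (view α m i).Hidden j l) (hl : l ≤ m) : j ≠ i := by
  rintro rfl
  exact hj.1 (self_mem_nodes_view_of_le hl)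

/-- The node `(i, l + 1)` is seen and cannot have heard from `j`, as otherwise `(j, l)` would be
seen; this proves the crash at every later time. -/
theorem not_hidden_of_lt (hj : (view α m i).Hidden j l) (hl : l < s) (hs : s ≤ m) :
    ¬ (view α m i).Hidden j s := by
  refine fun hh => hh.2 ⟨i, l, hl, self_mem_nodes_view_of_le (hl.trans_le hs), fun he => ?_⟩
  rcases eq_or_edge_of_mem_edges_view he with h | h
  · exact ne_of_hidden hj (hl.le.trans hs) h
  · exact not_edge_of_hidden hj (hl.trans_le hs) h

/-- A process is hidden at one time at most. -/
theorem hidden_level_unique (hj : (view α m i).Hidden j l) (hj' : (view α m i).Hidden j s)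
    (hl : l ≤ m) (hs : s ≤ m) : l = s := by
  rcases lt_trichotomy l s with h | h | h
  · exact absurd hj' (not_hidden_of_lt hj h hs)
  · exact h
  · exact absurd hj (not_hidden_of_lt hj' h hl)

end Views

/-! ### Hidden capacity as an attained maximum -/

namespace View

variable {n d : ℕ} {G : View n d} {m k : ℕ}

theorem bddAbove_hiddenCapacity (G : View n d) (m : ℕ) :
    BddAbove {c | ∀ l ≤ m, ∃ W : Finset (Fin n), W.card = c ∧ ∀ j ∈ W, G.Hidden j l} := by
  refine ⟨n, fun c hc => ?_⟩
  obtain ⟨W, rfl, -⟩ := hc 0 m.zero_le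
  simpa using W.card_le_univ

theorem le_hiddenCapacity_iff :
    k ≤ G.hiddenCapacity m ↔
      ∀ l ≤ m, ∃ W : Finset (Fin n), W.card = k ∧ ∀ j ∈ W, G.Hidden j l := by
  constructor
  · intro h l hl
    have hmem := Nat.sSup_mem ⟨0, fun l _ => ⟨∅, by simp⟩⟩ (bddAbove_hiddenCapacity G m)
    obtain ⟨W, hW, hW'⟩ := hmem l hl
    obtain ⟨W', hs, hc⟩ := Finset.exists_subset_card_eq (h.trans_eq hW.symm)
    exact ⟨W', hc, fun j hj => hW' j (hs hj)⟩
  · exact fun h => le_csSup (bddAbove_hiddenCapacity G m) h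

theorem minVal_mem {j : Fin n} {x : Fin (d + 1)} (h : (j, x) ∈ G.labels) :
    ∃ j, (j, G.minVal) ∈ G.labels :=
  csInf_mem (s := {x | ∃ j, (j, x) ∈ G.labels}) ⟨x, j, h⟩

theorem minVal_le {j : Fin n} {x : Fin (d + 1)} (h : (j, x) ∈ G.labels) : G.minVal ≤ x :=
  csInf_le (OrderBot.bddBelow _) ⟨j, h⟩

end View

/-! ### `optMin` solves set consensus -/

section OptMin

variable {n d k t : ℕ} {α : Adversary n d} {i : Fin n} {m : ℕ} {x : Fin (d + 1)}

theorem minVal_view_mem (α : Adversary n d) (m : ℕ) (i : Fin n) :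
    ∃ j, (j, (view α m i).minVal) ∈ (view α m i).labels :=
  View.minVal_mem (self_mem_labels_view α i m)

open Classical in
theorem optMin_decide (α : Adversary n d) (m : ℕ) (i : Fin n) :
    (optMin n d k).decide i m ((optMin n d k).state α m i) =
      if (view α m i).Low k ∨ (view α m i).hiddenCapacity m < k then some (view α m i).minVal
      else none := by
  unfold optMin
  rw [state_fullInformation]
  rfl

theorem optMin_decidesAt (h : (optMin n d k).DecidesAt α i m x) :
    x = (view α m i).minVal ∧ ((view α m i).Low k ∨ (view α m i).hiddenCapacity m < k) := by
  have := h.2.1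
  rw [optMin_decide] at this
  split_ifs at this with hc
  exact ⟨(Option.some.inj this).symm, hc⟩

theorem Protocol.exists_decidesAt_of_decide {P : Protocol.{u} n d} (hi : α.pattern.Active i m)
    (h : P.decide i m (P.state α m i) ≠ none) : ∃ m' ≤ m, ∃ y, P.DecidesAt α i m' y := by
  classical
  have hex : ∃ m, P.decide i m (P.state α m i) ≠ none := ⟨m, h⟩
  obtain ⟨y, hy⟩ := Option.ne_none_iff_exists'.1 (Nat.find_spec hex)
  exact ⟨Nat.find hex, Nat.find_min' hex h, y, hi.mono (Nat.find_min' hex h), hy,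
    fun m' hm' => not_not.1 (Nat.find_min hex hm')⟩

theorem optMin_exists_decidesAt (hi : α.pattern.Active i m)
    (h : (view α m i).Low k ∨ (view α m i).hiddenCapacity m < k) :
    ∃ m' ≤ m, ∃ y, (optMin n d k).DecidesAt α i m' y := by
  refine Protocol.exists_decidesAt_of_decide hi ?_
  rw [optMin_decide, if_pos h]
  simp

theorem optMin_validity (α : Adversary n d) : (optMin n d k).Validity α := by
  intro i m x hx
  obtain ⟨j, hj⟩ := minVal_view_mem α m i
  exact ⟨j, ((mem_labels_view_iff.1 hj).2.symm).trans (optMin_decidesAt hx).1.symm⟩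

/-- Pigeonhole: hidden nodes at the `n + 1` times `0, …, n` would belong to distinct processes. This
gives termination by time `n`. -/
theorem hiddenCapacity_view_eq_zero (α : Adversary n d) (i : Fin n) :
    (view α n i).hiddenCapacity n = 0 := by
  by_contra h
  have h1 := View.le_hiddenCapacity_iff.1 (Nat.one_le_iff_ne_zero.2 h)
  have h2 : ∀ l : Fin (n + 1), ∃ j, (view α n i).Hidden j l := fun l => by
    obtain ⟨W, hW, hW'⟩ := h1 l (Nat.lt_succ_iff.1 l.2)
    obtain ⟨j, rfl⟩ := Finset.card_eq_one.1 hW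
    exact ⟨j, hW' j (by simp)⟩
  choose f hf using h2
  have hinj : Function.Injective f := fun a b hab => Fin.ext <|
    hidden_level_unique (hf a) (hab ▸ hf b) (Nat.lt_succ_iff.1 a.2) (Nat.lt_succ_iff.1 b.2)
  simpa using Fintype.card_le_of_injective f hinj

theorem optMin_decision (hk : 1 ≤ k) (α : Adversary n d) : (optMin n d k).Decision α := by
  intro i hi
  obtain ⟨m, -, y, hy⟩ := optMin_exists_decidesAt (k := k) (hi.active n)
    (Or.inr (by rw [hiddenCapacity_view_eq_zero]; omega))
  exact ⟨m, y, hy⟩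

theorem optMin_agreement (α : Adversary n d) : (optMin n d k).Agreement k α := by
  unfold Protocol.Agreement
  set D := {x | ∃ i m, α.pattern.Correct i ∧ (optMin n d k).DecidesAt α i m x} with hD
  by_contra! hcard
  have hne : D.Nonempty := by
    rw [← Set.ncard_pos]
    omega
  obtain ⟨i, m, hi, hdec⟩ : sSup D ∈ D := hne.csSup_mem D.toFinite
  have hmax : ∀ v ∈ D, v ≤ sSup D := fun v hv => le_csSup (OrderTop.bddAbove _) hv
  obtain ⟨hw, hc⟩ := optMin_decidesAt hdec
  rcases hc with hlow | hcap
  · have : D.ncard ≤ k := by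
      rw [← Set.ncard_image_of_injective D Fin.val_injective]
      refine (Set.ncard_le_ncard (t := (Finset.range k : Set ℕ)) ?_ (Finset.finite_toSet _)).trans
        (by simp)
      rintro _ ⟨v, hv, rfl⟩
      have h1 : (v : ℕ) ≤ ((view α m i).minVal : ℕ) := by
        rw [← hw]
        exact hmax v hv
      simpa using h1.trans_lt hlow
    omega
  · rw [← not_le, View.le_hiddenCapacity_iff] at hcap
    push Not at hcap
    obtain ⟨l, hl, hW⟩ := hcap
    -- Each smaller decided value is attached to a hidden node at time `l` of which it is the
    -- minimum seen value, so the node determines the value.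
    have key : ∀ v : (D \ {sSup D} : Set (Fin (d + 1))), ∃ q, (view α m i).Hidden q l ∧
        (∃ a, (a, v.1) ∈ (view α l q).labels) ∧
        ∀ a y, (a, y) ∈ (view α l q).labels → v.1 ≤ y := by
      rintro ⟨v, ⟨j, mj, hj, hdj⟩, hv⟩
      obtain ⟨hvmin, -⟩ := optMin_decidesAt hdj
      have hlt : v < (view α m i).minVal := by
        rw [← hw]
        exact lt_of_le_of_ne (hmax v ⟨j, mj, hj, hdj⟩) hv
      obtain ⟨a, ha⟩ := minVal_view_mem α mj j
      rw [← hvmin] at ha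
      have hun : (a, v) ∉ (view α m i).labels := fun h =>
        absurd (View.minVal_le h) (not_le.2 hlt)
      -- Had the correct process `j` decided earlier, its next message would have shown the value to
      -- `i` by time `m`.
      have hm : m ≤ mj := by
        by_contra! hm
        refine hun (labels_view_subset (q := j) (l := mj) ?_ ha)
        exact mem_nodes_view_of_succ (self_mem_nodes_view_of_le hm)
          (Or.inr ((hj.active _).edge le_rfl))
      obtain ⟨q, hq1, hq2, hq3⟩ :=
        exists_active_of_mem_labels_view (hl.trans hm) (hj.active mj) ha
      refine ⟨q, ⟨fun hs => hun (labels_view_subset hs hq2),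
        not_guaranteedCrashed_of_active hq1⟩, ⟨a, hq2⟩, fun a y hy => ?_⟩
      simp only
      rw [hvmin]
      exact View.minVal_le (hq3 hy)
    choose f hf1 hf2 hf3 using key
    have hinj : Function.Injective f := fun v v' hvv => by
      obtain ⟨a, ha⟩ := hf2 v
      obtain ⟨a', ha'⟩ := hf2 v'
      exact Subtype.ext (le_antisymm (hf3 v _ _ (hvv ▸ ha')) (hf3 v' _ _ (hvv ▸ ha)))
    have hcard' : k ≤ (Set.range f).ncard := by
      rw [← Set.image_univ, Set.ncard_image_of_injective _ hinj, Set.ncard_univ,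
        Nat.card_coe_set_eq, Set.ncard_sdiff_singleton_of_mem (show sSup D ∈ D from ⟨i, m, hi, hdec⟩)]
      omega
    classical
    rw [Set.ncard_eq_toFinset_card'] at hcard'
    obtain ⟨W, hWs, hWc⟩ := Finset.exists_subset_card_eq hcard'
    obtain ⟨j, hj, hj'⟩ := hW W hWc
    obtain ⟨v, rfl⟩ := Set.mem_toFinset.1 (hWs hj)
    exact hj' (hf1 v)

theorem optMin_solvesSetConsensus (hk : 1 ≤ k) (γ : Set (Adversary n d)) :
    (optMin n d k).SolvesSetConsensus k γ := fun α _ =>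
  ⟨optMin_agreement α, optMin_decision hk α, optMin_validity α⟩

end OptMin

end SetConsensus

namespace SetConsensus

/-! ### Indistinguishable runs -/

namespace Protocol

variable {n d : ℕ} {P : Protocol.{u} n d} {α β : Adversary n d} {j : Fin n} {m : ℕ}
  {x : Fin (d + 1)}

/-- The states at a set of nodes that is closed under the delivery of messages depend only on
the inputs at these nodes and on the messages delivered to them. -/
theorem state_congr (P : Protocol.{u} n d) {V : Fin n → ℕ → Prop}
    (hinput : ∀ j, V j 0 → α.input j = β.input j)
    (hself : ∀ h s, V h (s + 1) → V h s)
    (hedge : ∀ j h s, V h (s + 1) → (α.pattern.Edge (s + 1) j h ↔ β.pattern.Edge (s + 1) j h))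
    (hsend : ∀ j h s, V h (s + 1) → α.pattern.Edge (s + 1) j h → V j s) :
    ∀ s j, V j s → P.state α s j = P.state β s j := by
  intro s
  induction s with
  | zero =>
    intro j hj
    simp only [state, hinput j hj]
  | succ s ih =>
    intro h hh
    simp only [state, ih h (hself h s hh)]
    congr 1
    funext j
    by_cases hE : α.pattern.Edge (s + 1) j h
    · rw [if_pos hE, if_pos ((hedge j h s hh).1 hE), ih j (hsend j h s hh hE)]
    · rw [if_neg hE, if_neg (fun h' => hE ((hedge j h s hh).2 h'))]

theorem DecidesAt.congr (h : P.DecidesAt α j m x) (hj : β.pattern.Active j m)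
    (hst : ∀ s ≤ m, P.state α s j = P.state β s j) : P.DecidesAt β j m x :=
  ⟨hj, hst m le_rfl ▸ h.2.1, fun s hs => hst s hs.le ▸ h.2.2 s hs⟩

end Protocol

/-- Descending greedily from `U`, removing at each step the element that labels the current set,
one reaches a set `T` not labelled by one of its elements, such that all elements of `U` outside
`T` occur as labels of the sets that were passed. -/
theorem exists_rainbow_chain {ι β : Type*} [DecidableEq ι] (e : ι → β) (y : Finset ι → β)
    (U : Finset ι) :
    ∃ (T : Finset ι) (C : Finset (Finset ι)), T ∈ C ∧ (∀ c ∈ T, y T ≠ e c) ∧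
      (∀ P ∈ C, T ⊆ P ∧ P ⊆ U) ∧ (∀ P ∈ C, P ≠ T → ∃ c ∈ P, y P = e c) ∧
      (∀ c ∈ U, c ∉ T → ∃ P ∈ C, y P = e c) ∧
      ∀ P ∈ C, ∀ P' ∈ C, P.card = P'.card → P = P' := by
  induction U using Finset.strongInduction with
  | H U ih =>
    by_cases hU : ∃ c ∈ U, y U = e c
    · obtain ⟨c, hc, hyc⟩ := hU
      obtain ⟨T, C, hTC, hT, h3, h4, h5, h6⟩ := ih (U.erase c) (Finset.erase_ssubset hc)
      have hlt : ∀ P ∈ C, P.card < U.card := fun P hP =>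
        Finset.card_lt_card (((h3 P hP).2).trans_ssubset (Finset.erase_ssubset hc))
      refine ⟨T, insert U C, Finset.mem_insert_of_mem hTC, hT, ?_, ?_, ?_, ?_⟩
      · intro P hP
        rcases Finset.mem_insert.1 hP with rfl | hP
        · exact ⟨(h3 T hTC).2.trans (Finset.erase_subset _ _), subset_rfl⟩
        · exact ⟨(h3 P hP).1, (h3 P hP).2.trans (Finset.erase_subset _ _)⟩
      · intro P hP hPT
        rcases Finset.mem_insert.1 hP with rfl | hP
        · exact ⟨c, hc, hyc⟩
        · exact h4 P hP hPT
      · intro a ha haT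
        by_cases hac : a = c
        · exact ⟨U, Finset.mem_insert_self _ _, hac ▸ hyc⟩
        · obtain ⟨P, hP, hy⟩ := h5 a (Finset.mem_erase.2 ⟨hac, ha⟩) haT
          exact ⟨P, Finset.mem_insert_of_mem hP, hy⟩
      · intro P hP P' hP' hcard
        rcases Finset.mem_insert.1 hP with rfl | h1 <;>
          rcases Finset.mem_insert.1 hP' with rfl | h2
        · rfl
        · exact absurd hcard (hlt P' h2).ne'
        · exact absurd hcard (hlt P h1).ne
        · exact h6 P h1 P' h2 hcard
    · push Not at hU
      refine ⟨U, {U}, by simp, hU, by simp, ?_, fun c hc hc' => absurd hc hc', ?_⟩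
      · intro P hP hPU
        exact absurd (Finset.mem_singleton.1 hP) hPU
      · simp +contextual

/-- `Chains.pattern` treats a member that reaches everyone as correct; a member reaching only its
successor must not fall under this convention. -/
theorem singleton_ne_univ {n : ℕ} (hn : 2 ≤ n) (x : Fin n) : ({x} : Set (Fin n)) ≠ Set.univ := by
  have := Fin.nontrivial_iff_two_le.2 hn
  exact Set.singleton_ne_univ x

/-- `k` disjoint chains `node 0 b, …, node m b` of processes other than `i`, the members of which
at times before `m` are faulty; `pos` locates a process in the chains. -/
structure Chains {n : ℕ} (k : ℕ) (F : FailurePattern n) (i : Fin n) (m : ℕ) where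
  node : ℕ → Fin k → Fin n
  pos : Fin n → Option (ℕ × Fin k)
  pos_node : ∀ r ≤ m, ∀ b, pos (node r b) = some (r, b)
  of_pos : ∀ j r b, pos j = some (r, b) → r ≤ m ∧ j = node r b
  pos_self : pos i = none
  not_correct : ∀ r < m, ∀ b, ¬ F.Correct (node r b)

/-! ### Adversaries with chains of crashes -/

namespace Chains

variable {n k m d t : ℕ} {F : FailurePattern n} {i : Fin n} (X : Chains k F i m)

open Classical in
/-- The failure pattern in which `i` is correct and the chain member `node r b` crashes in round
`r + 1`, where it reaches `ρ r b` (but is correct if this is everyone). -/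
noncomputable def pattern (ρ : ℕ → Fin k → Set (Fin n)) : FailurePattern n where
  crashRound j := if j = i then ⊤ else
    match X.pos j with
    | none => F.crashRound j
    | some (r, b) => if ρ r b = Set.univ then ⊤ else ((r + 1 : ℕ) : ℕ∞)
  one_le_crashRound j := by
    split_ifs
    · exact le_top
    · split
      · exact F.one_le_crashRound j
      · split_ifs
        · exact le_top
        · exact_mod_cast Nat.le_add_left 1 _
  reach j :=
    match X.pos j with
    | none => F.reach j
    | some (r, b) => ρ r b

open Classical in
/-- The adversary in which the chains in `S` start with the input `b` at `node 0 b`, and all other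
inputs are as in `v`. -/
noncomputable def adversary (v : Fin n → Fin (d + 1)) (hkd : k ≤ d) (S : Set (Fin k))
    (ρ : ℕ → Fin k → Set (Fin n)) : Adversary n d where
  input j :=
    match X.pos j with
    | some (0, b) => if b ∈ S then Fin.castLE (by omega) b else v j
    | _ => v j
  pattern := X.pattern ρ

variable {X} {ρ ρ' : ℕ → Fin k → Set (Fin n)} {r s l : ℕ} {b : Fin k} {j h p : Fin n}

theorem node_ne (hr : r ≤ m) : X.node r b ≠ i := fun h => by
  have h1 := X.pos_node r hr b
  rw [h, X.pos_self] at h1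
  cases h1

theorem node_inj {c : Fin k} (hr : r ≤ m) (hs : s ≤ m) (h : X.node r b = X.node s c) :
    r = s ∧ b = c := by
  have h1 := X.pos_node r hr b
  rw [h, X.pos_node s hs c] at h1
  simpa [eq_comm] using h1

theorem correct_self : (X.pattern ρ).Correct i := by
  simp [FailurePattern.Correct, pattern]

theorem correct_node (hr : r ≤ m) (hρ : ρ r b = Set.univ) :
    (X.pattern ρ).Correct (X.node r b) := by
  simp [FailurePattern.Correct, pattern, X.pos_node r hr, hρ]

theorem active_node (hr : r ≤ m) : (X.pattern ρ).Active (X.node r b) r := by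
  simp only [FailurePattern.Active, pattern, if_neg (node_ne hr), X.pos_node r hr]
  split_ifs
  · exact ENat.natCast_lt_top r
  · exact Nat.cast_lt.2 r.lt_succ_self

theorem edge_node (hr : r ≤ m) : (X.pattern ρ).Edge (s + 1) (X.node r b) h ↔
    s < r ∨ ρ r b = Set.univ ∨ (s = r ∧ h ∈ ρ r b) := by
  simp only [FailurePattern.Edge, pattern, if_neg (node_ne hr), X.pos_node r hr]
  split_ifs with hu
  · have := ENat.natCast_lt_top (s + 1)
    tauto
  · simp only [Nat.cast_lt, Nat.cast_inj, add_lt_add_iff_right, add_left_inj]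
    tauto

theorem edge_of_pos_eq_none (hj : X.pos j = none) :
    (X.pattern ρ).Edge s j h ↔ j = i ∨ F.Edge s j h := by
  by_cases hji : j = i
  · simp only [hji, true_or, iff_true]
    exact (correct_self.active s).edge le_rfl
  · simp [FailurePattern.Edge, pattern, hji, hj]

/-- Only members at times before `m` are made to crash, and these are already faulty in `F`, so no
new faults arise. -/
theorem adversary_mem {v : Fin n → Fin (d + 1)} {hkd : k ≤ d} {S : Set (Fin k)}
    (hF : {i | ¬ F.Correct i}.ncard ≤ t) (hρ : ∀ r, m ≤ r → ∀ b, ρ r b = Set.univ) :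
    X.adversary v hkd S ρ ∈ crashContext n d t := by
  refine (Set.ncard_le_ncard (fun j (hj : ¬ (X.pattern ρ).Correct j) => ?_)).trans hF
  cases hp : X.pos j with
  | none =>
    have hji : j ≠ i := by
      rintro rfl
      exact hj correct_self
    simpa [FailurePattern.Correct, pattern, hp, hji] using hj
  | some q =>
    obtain ⟨r, b⟩ := q
    obtain ⟨hr, rfl⟩ := X.of_pos j r b hp
    refine X.not_correct r ?_ b
    by_contra! hmr
    exact hj (correct_node hr (hρ r hmr b))

theorem input_eq_or {v : Fin n → Fin (d + 1)} {hkd : k ≤ d} {S : Set (Fin k)} :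
    (X.adversary v hkd S ρ).input j = v j ∨
      ∃ b ∈ S, (X.adversary v hkd S ρ).input j = Fin.castLE (by omega) b := by
  simp only [adversary]
  split
  · split_ifs with hb
    · exact Or.inr ⟨_, hb, rfl⟩
    · exact Or.inl rfl
  · exact Or.inl rfl

theorem input_node {v : Fin n → Fin (d + 1)} {hkd : k ≤ d} {S : Set (Fin k)} (hb : b ∈ S) :
    (X.adversary v hkd S ρ).input (X.node 0 b) = Fin.castLE (by omega) b := by
  simp [adversary, X.pos_node 0 m.zero_le, hb]

theorem input_congr {v : Fin n → Fin (d + 1)} {hkd : k ≤ d} {S S' : Set (Fin k)}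
    (h : ∀ b, X.pos j = some (0, b) → (b ∈ S ↔ b ∈ S')) :
    (X.adversary v hkd S ρ).input j = (X.adversary v hkd S' ρ').input j := by
  rcases hj : X.pos j with _ | ⟨_ | r, b⟩
  · simp [adversary, hj]
  · have := h b hj
    by_cases hb : b ∈ S
    · simp [adversary, hj, hb, this.1 hb]
    · simp [adversary, hj, hb, mt this.2 hb]
  · simp [adversary, hj]

variable (X) in
/-- Before time `l`, each chain member reaches only the next member of its chain. -/
def IsChainBelow (l : ℕ) (ρ : ℕ → Fin k → Set (Fin n)) : Prop :=
  ∀ r b, r + 1 < l → ρ r b = {X.node (r + 1) b}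

variable (X) in
/-- The chain members at times before `l` reach only the next member of their chain, those at time
`l` reach `R`, and the later ones are correct. -/
def reachAt (l : ℕ) (R : Fin k → Set (Fin n)) (r : ℕ) (b : Fin k) : Set (Fin n) :=
  if r < l then {X.node (r + 1) b} else if r = l then R b else Set.univ

theorem isChainBelow_reachAt (R : Fin k → Set (Fin n)) :
    X.IsChainBelow (l + 1) (X.reachAt l R) := fun r b hr => by
  rw [reachAt, if_pos (by omega)]

theorem reachAt_self (R : Fin k → Set (Fin n)) : X.reachAt l R l b = R b := by
  simp [reachAt]

theorem reachAt_of_lt (R : Fin k → Set (Fin n)) (hr : l < r) :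
    X.reachAt l R r b = Set.univ := by
  simp [reachAt, hr.not_gt, hr.ne']

theorem IsChainBelow.mono (hρ : X.IsChainBelow l ρ) (hs : s ≤ l) : X.IsChainBelow s ρ :=
  fun r b hr => hρ r b (hr.trans_le hs)

/-- The state at time `l` of a process that is not in a chain, or only at time `l` or later,
depends only on the set of chain members that reach it in round `l`, and on the inputs at the
start of their chains. -/
theorem state_eq (Q : Protocol.{u} n d) {v : Fin n → Fin (d + 1)} {hkd : k ≤ d}
    {S S' : Set (Fin k)} (hn : 2 ≤ n) (hl : l ≤ m) (hρ : X.IsChainBelow l ρ)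
    (hρ' : X.IsChainBelow l ρ') (P : Set (Fin k))
    (hp : ∀ r b, X.pos p = some (r, b) → l ≤ r)
    (hp0 : ∀ b, X.pos p = some (0, b) → b ∈ P)
    (hS : ∀ b ∈ P, b ∈ S ↔ b ∈ S')
    (hP : ∀ r b, r + 1 = l → (p ∈ ρ r b ↔ p ∈ ρ' r b) ∧ (p ∈ ρ r b → b ∈ P)) (hs : s ≤ l) :
    Q.state (X.adversary v hkd S ρ) s p = Q.state (X.adversary v hkd S' ρ') s p := by
  -- Before time `l`, the set omits each chain member after its own time, and also at that time if
  -- its chain is outside `P`; at time `l` only `p` remains.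
  refine Q.state_congr (V := fun h s =>
    (s < l ∧ ∀ r b, X.pos h = some (r, b) → r ≤ s → r = s ∧ b ∈ P) ∨ (h = p ∧ s = l))
    ?_ ?_ ?_ ?_ s p ?_
  · rintro j (⟨h0, hj⟩ | ⟨rfl, -⟩)
    · exact input_congr fun b hb => hS b (hj 0 b hb le_rfl).2
    · exact input_congr fun b hb => hS b (hp0 b hb)
  · rintro h s (⟨h0, hj⟩ | ⟨rfl, h0⟩)
    · refine Or.inl ⟨by omega, fun r b hb hr => ?_⟩
      have := (hj r b hb (by omega)).1
      omega
    · refine Or.inl ⟨by omega, fun r b hb hr => ?_⟩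
      have := hp r b hb
      omega
  · intro j h s hh
    show (X.pattern ρ).Edge _ _ _ ↔ (X.pattern ρ').Edge _ _ _
    have hsl : s + 1 ≤ l := by
      rcases hh with hh | hh
      · exact hh.1.le
      · exact hh.2.le
    cases hj : X.pos j with
    | none => rw [edge_of_pos_eq_none hj, edge_of_pos_eq_none hj]
    | some q =>
      obtain ⟨r, b⟩ := q
      obtain ⟨hr, rfl⟩ := X.of_pos j r b hj
      rw [edge_node hr, edge_node hr]
      by_cases hsr : s < r
      · simp [hsr]
      · by_cases hrl : r + 1 < l
        · rw [hρ r b hrl, hρ' r b hrl]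
        · obtain rfl : s = r := by omega
          have hh' : h = p := by
            rcases hh with hh | hh
            · omega
            · exact hh.1
          subst hh'
          have h1 := (hP s b (by omega)).1
          have h2 : ∀ A : Set (Fin n), (A = Set.univ ∨ s = s ∧ h ∈ A) ↔ h ∈ A := fun A =>
            ⟨fun hA => hA.elim (fun hA => hA ▸ Set.mem_univ _) And.right,
              fun hA => Or.inr ⟨rfl, hA⟩⟩
          rw [h2, h2, h1]
  · intro j h s hh hE
    replace hE : (X.pattern ρ).Edge _ _ _ := hE
    have hsl : s + 1 ≤ l := by
      rcases hh with hh | hh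
      · exact hh.1.le
      · exact hh.2.le
    refine Or.inl ⟨by omega, fun r b hb hrs => ?_⟩
    obtain ⟨hr, rfl⟩ := X.of_pos j r b hb
    rw [edge_node hr] at hE
    by_cases hrl : r + 1 < l
    · rw [hρ r b hrl] at hE
      rcases hE with hE | hE | ⟨rfl, rfl⟩
      · omega
      · exact absurd hE (singleton_ne_univ hn _)
      · rcases hh with hh | hh
        · exact ⟨rfl, (hh.2 (s + 1) b (X.pos_node _ (by omega) b) le_rfl).2⟩
        · omega
    · obtain rfl : s = r := by omega
      have hh' : h = p := by
        rcases hh with hh | hh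
        · omega
        · exact hh.1
      subst hh'
      refine ⟨rfl, (hP s b (by omega)).2 ?_⟩
      rcases hE with hE | hE | hE
      · omega
      · exact hE ▸ Set.mem_univ _
      · exact hE.2
  · rcases hs.lt_or_eq with hs | hs
    · refine Or.inl ⟨hs, fun r b hb hr => ?_⟩
      have := hp r b hb
      omega
    · exact Or.inr ⟨rfl, hs⟩

theorem mem_labels_node {v : Fin n → Fin (d + 1)} {hkd : k ≤ d} {S : Set (Fin k)} (hb : b ∈ S)
    (hl : l ≤ m) (hρ : X.IsChainBelow (l + 1) ρ) :
    (X.node 0 b, Fin.castLE (by omega) b) ∈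
      (view (X.adversary v hkd S ρ) l (X.node l b)).labels := by
  induction l with
  | zero =>
    have := self_mem_labels_view (X.adversary v hkd S ρ) (X.node 0 b) 0
    rwa [input_node hb] at this
  | succ l ih =>
    refine mem_labels_view_succ.2 (Or.inr ⟨X.node l b, ?_, ih (by omega) (hρ.mono (by omega))⟩)
    refine (edge_node (by omega)).2 (Or.inr (Or.inr ⟨rfl, ?_⟩))
    rw [hρ l b (by omega)]
    rfl

theorem mem_labels_of_mem_reach {v : Fin n → Fin (d + 1)} {hkd : k ≤ d} {S : Set (Fin k)}
    (hb : b ∈ S) (hl : l ≤ m) (hρ : X.IsChainBelow (l + 1) ρ) (hp : p ∈ ρ l b) :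
    (X.node 0 b, Fin.castLE (by omega) b) ∈
      (view (X.adversary v hkd S ρ) (l + 1) p).labels :=
  mem_labels_view_succ.2 (Or.inr ⟨X.node l b, (edge_node hl).2 (Or.inr (Or.inr ⟨rfl, hp⟩)),
    mem_labels_node hb hl hρ⟩)

end Chains

/-! ### Decisions forced at the end of a chain -/

section Unbeatable

variable {n k d t m : ℕ} {Q : Protocol.{u} n d}

/-- The `k` low values exhaust what agreement allows. -/
theorem lt_of_decides_all (hkd : k ≤ d) {β : Adversary n d} (hQ : Q.Agreement k β)
    (hlow : ∀ c : Fin k, ∃ j s, β.pattern.Correct j ∧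
      Q.DecidesAt β j s (Fin.castLE (by omega) c))
    {y : Fin (d + 1)} (hy : ∃ j s, β.pattern.Correct j ∧ Q.DecidesAt β j s y) : (y : ℕ) < k := by
  by_contra! hky
  have hkd' : k ≤ d + 1 := by omega
  have hnot : y ∉ Set.range (Fin.castLE hkd') := by
    rintro ⟨c, rfl⟩
    exact absurd c.2 (not_lt.2 hky)
  have hsub : insert y (Set.range (Fin.castLE hkd')) ⊆
      {x | ∃ i m, β.pattern.Correct i ∧ Q.DecidesAt β i m x} := by
    rintro _ (rfl | ⟨c, rfl⟩)
    · exact hy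
    · exact hlow c
  have h1 := Set.ncard_le_ncard hsub
  rw [Set.ncard_insert_of_notMem hnot, ← Set.image_univ,
    Set.ncard_image_of_injective _ (Fin.castLE_injective hkd'), Set.ncard_univ,
    Nat.card_eq_fintype_card, Fintype.card_fin] at h1
  have h2 : Set.ncard _ ≤ k := hQ
  omega

/-- A low value makes `optMin` decide, and domination passes the deadline on to `Q`. -/
theorem decidesAt_of_mem_labels (hkd : k ≤ d)
    (hdom : Protocol.Dominates (crashContext n d t) Q (optMin n d k)) {β : Adversary n d}
    (hβ : β ∈ crashContext n d t) {j p : Fin n} {s : ℕ} (hp : β.pattern.Active p s) {b : Fin k}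
    (hb : (j, Fin.castLE (by omega) b) ∈ (view β s p).labels) :
    ∃ s' ≤ s, ∃ y, Q.DecidesAt β p s' y := by
  obtain ⟨s', hs', x, hx⟩ := optMin_exists_decidesAt (k := k) hp
    (Or.inl (lt_of_le_of_lt (Fin.le_def.1 (View.minVal_le hb)) b.2))
  obtain ⟨s'', hs'', y, hy⟩ := hdom β hβ p s' x hx
  exact ⟨s'', hs''.trans hs', y, hy⟩

variable {F : FailurePattern n} {i : Fin n} {v : Fin n → Fin (d + 1)}

/-- The last member of a chain decides on the value that the chain carries. -/
theorem Chains.decidesAt_node (X : Chains k F i m) (hn : 2 ≤ n) (hkd : k ≤ d)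
    (hQ : Q.SolvesSetConsensus k (crashContext n d t))
    (hdom : Protocol.Dominates (crashContext n d t) Q (optMin n d k))
    (hF : {i | ¬ F.Correct i}.ncard ≤ t) (hv : ∀ j, k ≤ (v j : ℕ)) {l : ℕ} (hl : l ≤ m)
    {b : Fin k} {S : Set (Fin k)} (hb : b ∈ S) {ρ : ℕ → Fin k → Set (Fin n)}
    (hρ : X.IsChainBelow (l + 1) ρ) (hρm : ∀ r, m ≤ r → ∀ b, ρ r b = Set.univ) :
    ∃ s ≤ l, Q.DecidesAt (X.adversary v hkd S ρ) (X.node l b) s (Fin.castLE (by omega) b) := by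
  induction l generalizing b S ρ with
  | zero =>
    have hmem : X.adversary v hkd S ρ ∈ crashContext n d t := adversary_mem hF hρm
    obtain ⟨s, hs, y, hy⟩ := decidesAt_of_mem_labels hkd hdom hmem
      (active_node (X := X) (ρ := ρ) (b := b) m.zero_le) (mem_labels_node hb hl hρ)
    obtain rfl : s = 0 := by omega
    refine ⟨0, le_rfl, ?_⟩
    -- At time `0` the process knows only its own input, so it decides as in the failure-free run
    -- where all inputs are `b`; validity there leaves only `b`.
    let β : Adversary n d :=
      ⟨fun _ => Fin.castLE (by omega) b, ⟨fun _ => ⊤, fun _ => le_top, fun _ => ∅⟩⟩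
    have hβ : β ∈ crashContext n d t := by
      simp [β, crashContext, FailurePattern.Correct]
    obtain ⟨j, hj⟩ := (hQ β hβ).2.2 _ 0 y (hy.congr (ENat.natCast_lt_top 0) fun s hs => by
      obtain rfl : s = 0 := by omega
      simp only [Protocol.state, input_node hb, β])
    rw [show Fin.castLE (by omega) b = y from hj]
    exact hy
  | succ l ih =>
    classical
    have hlm : l < m := by omega
    -- Here the chains heard from in round `l + 1` are exactly those in `P`.
    let solo : Finset (Fin k) → Adversary n d := fun P =>
      X.adversary v hkd P (X.reachAt l fun c => if c ∈ P then Set.univ else ∅)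
    have hreach : ∀ R : Fin k → Set (Fin n), ∀ r, m ≤ r → ∀ b, X.reachAt l R r b = Set.univ :=
      fun R r hr b => reachAt_of_lt R (by omega)
    have hsolo : ∀ P, solo P ∈ crashContext n d t := fun P => adversary_mem hF (hreach _)
    -- These are `k + 1` processes, all correct here, which can serve as receivers in round `l + 1`.
    let Top : Fin n → Prop := fun p => p = i ∨ ∃ c, p = X.node (l + 1) c
    have hTop : ∀ p, Top p → ∀ R : Fin k → Set (Fin n),
        (X.pattern (X.reachAt l R)).Correct p := by
      rintro p (rfl | ⟨c, rfl⟩) R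
      · exact correct_self
      · exact correct_node hl (reachAt_of_lt R (Nat.lt_succ_self l))
    have hpos : ∀ p, Top p → ∀ r b, X.pos p = some (r, b) → l + 1 ≤ r := by
      rintro p (rfl | ⟨c, rfl⟩) r b hp
      · rw [X.pos_self] at hp
        cases hp
      · rw [X.pos_node _ hl] at hp
        simp only [Option.some.injEq, Prod.mk.injEq] at hp
        exact hp.1.le
    have hex : ∀ (p : Fin n) (P : Finset (Fin k)), Top p → P.Nonempty →
        ∃ y : Fin (d + 1), (∃ s ≤ l + 1, Q.DecidesAt (solo P) p s y) ∧
          ((∃ c ∈ P, y = Fin.castLE (by omega) c) ∨ k ≤ (y : ℕ)) := by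
      rintro p P hp ⟨c, hc⟩
      obtain ⟨s, hs, y, hy⟩ := decidesAt_of_mem_labels hkd hdom (hsolo P)
        ((hTop p hp _).active (l + 1))
        (mem_labels_of_mem_reach (b := c) (p := p) (Finset.mem_coe.2 hc) hlm.le
          (isChainBelow_reachAt _) (by simp [reachAt_self, hc]))
      refine ⟨y, ⟨s, hs, hy⟩, ?_⟩
      obtain ⟨j, hj⟩ := (hQ _ (hsolo P)).2.2 p s y hy
      rw [← hj]
      rcases input_eq_or (X := X) (v := v) (hkd := hkd) (S := P) (j := j)
        (ρ := X.reachAt l fun c => if c ∈ P then Set.univ else ∅) with h | ⟨c, hc, h⟩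
      · right
        simp only [solo, h]
        exact hv j
      · exact Or.inl ⟨c, Finset.mem_coe.1 hc, h⟩
    choose! f hf hf' using hex
    have hp0 : Top (X.node (l + 1) b) := Or.inr ⟨b, rfl⟩
    suffices hfb : f (X.node (l + 1) b) {b} = Fin.castLE (by omega) b by
      obtain ⟨s, hs, hdec⟩ := hf _ {b} hp0 (Finset.singleton_nonempty b)
      refine ⟨s, hs, hfb ▸ hdec.congr ((active_node hl).mono hs) fun s' hs' => ?_⟩
      refine state_eq Q hn hl (isChainBelow_reachAt _) (hρ.mono (Nat.le_succ _)) {b}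
        (hpos _ hp0) (fun c hc => ?_) ?_ ?_ (hs'.trans hs)
      · have := hpos _ hp0 _ _ hc
        omega
      · simp [hb]
      · rintro r c hr
        obtain rfl : r = l := by omega
        rw [reachAt_self, hρ r c (by omega)]
        have : X.node (r + 1) b = X.node (r + 1) c ↔ c = b :=
          ⟨fun h => (node_inj hl hl h).2.symm, fun h => h ▸ rfl⟩
        by_cases hcb : c = b <;> simp [hcb, this]
    by_contra hne
    -- The sets passed by the descent have distinct cardinalities, so nonempty ones can be told
    -- apart by `card - 1`.
    let idx : Finset (Fin k) → Fin k := fun P => ⟨P.card - 1, by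
      have := b.2
      have := card_finset_fin_le P
      omega⟩
    -- Giving slot `b` to `i` keeps `node (l + 1) b` free for the sets `∅` and `{b}`.
    let τ : Fin k → Fin n := fun c => if c = b then i else X.node (l + 1) c
    have hτ : ∀ c, Top (τ c) := fun c => by
      by_cases hc : c = b
      · exact Or.inl (if_pos hc)
      · exact Or.inr ⟨c, if_neg hc⟩
    have hτb : ∀ c, τ c ≠ X.node (l + 1) b := fun c hc => by
      by_cases hcb : c = b
      · simp only [τ, if_pos hcb] at hc
        exact node_ne hl hc.symm
      · simp only [τ, if_neg hcb] at hc
        exact hcb (node_inj hl hl hc).2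
    have hτinj : Function.Injective τ := fun c c' h => by
      by_cases hc : c = b <;> by_cases hc' : c' = b
      · rw [hc, hc']
      · simp only [τ, if_pos hc, if_neg hc'] at h
        exact absurd h.symm (node_ne hl)
      · simp only [τ, if_neg hc, if_pos hc'] at h
        exact absurd h (node_ne hl)
      · simp only [τ, if_neg hc, if_neg hc'] at h
        exact (node_inj hl hl h).2
    let proc : Finset (Fin k) → Fin n := fun P =>
      if P = ∅ ∨ P = {b} then X.node (l + 1) b else τ (idx P)
    -- The chains that `proc P` hears. If the descent ends at `∅`, the offending process that hears
    -- only `b` takes over.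
    let σ : Finset (Fin k) → Finset (Fin k) := fun P => if P = ∅ then {b} else P
    have hproc : ∀ P, Top (proc P) := fun P => by
      by_cases hP : P = ∅ ∨ P = {b}
      · simpa only [proc, if_pos hP] using hp0
      · simpa only [proc, if_neg hP] using hτ _
    have hσ : ∀ P, (σ P).Nonempty := fun P => by
      by_cases hP : P = ∅
      · simp [σ, hP]
      · simpa only [σ, if_neg hP] using Finset.nonempty_iff_ne_empty.2 hP
    have hsub : ∀ P, P ⊆ σ P := fun P => by
      by_cases hP : P = ∅
      · simp [hP]
      · simp [σ, hP]
    have hspecial : ∀ P, P = ∅ ∨ P = {b} → f (proc P) (σ P) = f (X.node (l + 1) b) {b} := by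
      rintro P (rfl | rfl)
      · simp [proc, σ]
      · simp [proc, σ]
    obtain ⟨T, C, hTC, hT, hC, hCT, hall, hcard⟩ := exists_rainbow_chain
      (Fin.castLE (by omega : k ≤ d + 1)) (fun P => f (proc P) (σ P)) Finset.univ
    -- The descent cannot go on from `{b}`, as that would require the decision `b`; hence `∅` and
    -- `{b}` never both occur.
    have hCspecial : ∀ P ∈ C, P = ∅ ∨ P = {b} → P = T := by
      intro P hP hPs
      by_contra hPT
      obtain ⟨c, hc, hyc⟩ := hCT P hP hPT
      rw [hspecial P hPs] at hyc
      rcases hPs with rfl | rfl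
      · simp at hc
      · rw [Finset.mem_singleton.1 hc] at hyc
        exact hne hyc
    have hinj : ∀ P ∈ C, ∀ P' ∈ C, proc P = proc P' → P = P' := by
      intro P hP P' hP' h
      by_cases h1 : P = ∅ ∨ P = {b} <;> by_cases h2 : P' = ∅ ∨ P' = {b}
      · rw [hCspecial P hP h1, hCspecial P' hP' h2]
      · simp only [proc, if_pos h1, if_neg h2] at h
        exact absurd h.symm (hτb _)
      · simp only [proc, if_neg h1, if_pos h2] at h
        exact absurd h (hτb _)
      · simp only [proc, if_neg h1, if_neg h2] at h
        have h3 := congrArg Fin.val (hτinj h)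
        simp only [idx] at h3
        push Not at h1 h2
        have h4 := Finset.card_pos.2 h1.1
        have h5 := Finset.card_pos.2 h2.1
        exact hcard P hP P' hP' (by omega)
    -- All the solo situations along the descent are realised in one run: `proc P` hears exactly `σ
    -- P`, and the members at time `l` of the chains in `T` are correct.
    let R : Fin k → Set (Fin n) := fun c =>
      if c ∈ T then Set.univ else {q | ∃ P ∈ C, c ∈ σ P ∧ proc P = q}
    have hR : ∀ P ∈ C, ∀ c, proc P ∈ R c ↔ c ∈ σ P := by
      intro P hP c
      by_cases hc : c ∈ T
      · simp only [R, if_pos hc, Set.mem_univ, true_iff]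
        exact hsub P ((hC P hP).1 hc)
      · simp only [R, if_neg hc, Set.mem_ofPred_eq]
        exact ⟨fun ⟨P', hP', hc', h⟩ => hinj P' hP' P hP h ▸ hc', fun h => ⟨P, hP, h, rfl⟩⟩
    have hdec : ∀ P ∈ C, ∃ j s, (X.pattern (X.reachAt l R)).Correct j ∧
        Q.DecidesAt (X.adversary v hkd Set.univ (X.reachAt l R)) j s (f (proc P) (σ P)) := by
      intro P hP
      obtain ⟨s, hs, h⟩ := hf (proc P) (σ P) (hproc P) (hσ P)
      refine ⟨proc P, s, hTop _ (hproc P) R, h.congr ((hTop _ (hproc P) R).active s)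
        fun s' hs' => ?_⟩
      refine state_eq Q hn hl (isChainBelow_reachAt _) (isChainBelow_reachAt _) (σ P)
        (hpos _ (hproc P)) (fun c hc => ?_) ?_ ?_ (hs'.trans hs)
      · have := hpos _ (hproc P) _ _ hc
        omega
      · simp
      · rintro r c hr
        obtain rfl : r = l := by omega
        rw [reachAt_self, reachAt_self, hR P hP]
        by_cases hc : c ∈ σ P <;> simp [hc]
    -- Low values in `T` are decided at time `l` by induction, the others by the `proc P`; hence the
    -- decision of `proc T` is low too. By validity it lies in `σ T`, against the choice of `T`, or
    -- against `hne` if `T` is empty.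
    have hlt := lt_of_decides_all hkd
      (hQ (X.adversary v hkd Set.univ (X.reachAt l R)) (adversary_mem hF (hreach R))).1
      (fun c => by
        by_cases hc : c ∈ T
        · obtain ⟨s, -, h⟩ := ih hlm.le (Set.mem_univ c) (isChainBelow_reachAt R) (hreach R)
          exact ⟨_, s, correct_node hlm.le (by rw [reachAt_self]; exact if_pos hc), h⟩
        · obtain ⟨P, hP, h⟩ := hall c (Finset.mem_univ c) hc
          exact h ▸ hdec P hP)
      (hdec T hTC)
    rcases hf' (proc T) (σ T) (hproc T) (hσ T) with ⟨c, hc, h⟩ | h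
    · by_cases hT0 : T = ∅
      · rw [hspecial T (Or.inl hT0)] at h
        simp only [σ, if_pos hT0, Finset.mem_singleton] at hc
        exact hne (hc ▸ h)
      · simp only [σ, if_neg hT0] at hc
        exact hT c hc (by simpa only [σ, if_neg hT0] using h)
    · exact absurd hlt (not_lt.2 h)

end Unbeatable

end SetConsensus

/-! ### From hidden nodes to chains, and unbeatability -/

namespace SetConsensus

variable {n k d t m : ℕ} {α : Adversary n d} {i : Fin n}

/-- Choose `k` hidden nodes at each time; by `hidden_level_unique` no process is chosen at two
times. One hidden before time `m` failed to reach `i` in the next round, hence is faulty. -/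
theorem exists_chains (hcap : k ≤ (view α m i).hiddenCapacity m) :
    ∃ X : Chains k α.pattern i m, ∀ r ≤ m, ∀ b, (view α m i).Hidden (X.node r b) r := by
  classical
  have h1 : ∀ r, ∃ f : Fin k → Fin n, r ≤ m →
      Function.Injective f ∧ ∀ b, (view α m i).Hidden (f b) r := by
    intro r
    by_cases hr : r ≤ m
    · obtain ⟨W, hW, hW'⟩ := View.le_hiddenCapacity_iff.1 hcap r hr
      exact ⟨W.orderEmbOfFin hW, fun _ => ⟨(W.orderEmbOfFin hW).injective,
        fun b => hW' _ (W.orderEmbOfFin_mem hW b)⟩⟩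
    · exact ⟨fun _ => i, fun h => absurd h hr⟩
  choose f hf using h1
  have huniq : ∀ r ≤ m, ∀ s ≤ m, ∀ b c, f r b = f s c → (r, b) = (s, c) := by
    intro r hr s hs b c h
    obtain rfl := hidden_level_unique ((hf r hr).2 b) (h ▸ (hf s hs).2 c) hr hs
    rw [(hf r hr).1 h]
  let pos : Fin n → Option (ℕ × Fin k) := fun j =>
    if h : ∃ q : ℕ × Fin k, q.1 ≤ m ∧ j = f q.1 q.2 then some h.choose else none
  refine ⟨⟨f, pos, ?_, ?_, ?_, ?_⟩, fun r hr b => (hf r hr).2 b⟩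
  · intro r hr b
    have h : ∃ q : ℕ × Fin k, q.1 ≤ m ∧ f r b = f q.1 q.2 := ⟨(r, b), hr, rfl⟩
    simp only [pos, dif_pos h]
    exact congrArg some (huniq r hr _ h.choose_spec.1 b _ h.choose_spec.2).symm
  · intro j r b hj
    simp only [pos] at hj
    split_ifs at hj with h
    have h2 := h.choose_spec
    rw [Option.some.inj hj] at h2
    exact h2
  · refine dif_neg ?_
    rintro ⟨q, hq, h⟩
    exact ne_of_hidden ((hf _ hq).2 q.2) hq h.symm
  · intro r hr b hc
    exact not_edge_of_hidden ((hf r hr.le).2 b) hr ((hc.active _).edge le_rfl)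

/-- A process cannot distinguish an adversary from the one in which the hidden processes form
chains, provided that the inputs it has seen are the same. -/
theorem state_eq_adversary (Q : Protocol.{u} n d) (hkd : k ≤ d) (hi : α.pattern.Active i m)
    {X : Chains k α.pattern i m}
    (hX : ∀ r ≤ m, ∀ b, (view α m i).Hidden (X.node r b) r) {v : Fin n → Fin (d + 1)}
    (hv : ∀ j, (j, 0) ∈ (view α m i).nodes → α.input j = v j) {ρ : ℕ → Fin k → Set (Fin n)}
    (hρ : X.IsChainBelow (m + 1) ρ) (hρm : ∀ b, ρ m b = Set.univ) (hn : 2 ≤ n)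
    {s : ℕ} (hs : s ≤ m) :
    Q.state α s i = Q.state (X.adversary v hkd ∅ ρ) s i := by
  refine Q.state_congr (V := fun h s => (h, s) ∈ (view α m i).nodes) ?_ ?_ ?_ ?_ s i
    (self_mem_nodes_view_of_le hs)
  · intro j hj
    rw [hv j hj]
    rcases Chains.input_eq_or (X := X) (v := v) (hkd := hkd) (S := ∅) (ρ := ρ) (j := j) with
      h | ⟨b, hb, -⟩
    · exact h.symm
    · exact absurd hb (Set.notMem_empty b)
  · exact fun h s hh => mem_nodes_view_of_succ hh (Or.inl rfl)
  · intro j h s hh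
    have hsm := le_of_mem_nodes_view hh
    show _ ↔ (X.pattern ρ).Edge _ _ _
    cases hj : X.pos j with
    | none =>
      rw [Chains.edge_of_pos_eq_none hj]
      refine ⟨Or.inr, ?_⟩
      rintro (rfl | hE)
      · exact hi.edge hsm
      · exact hE
    | some q =>
      obtain ⟨r, b⟩ := q
      obtain ⟨hr, rfl⟩ := X.of_pos j r b hj
      have hhid := hX r hr b
      have hlt : α.pattern.Edge (s + 1) (X.node r b) h → s < r := by
        intro hE
        by_contra! hrs
        exact hhid.1 (mem_nodes_view_of_le (mem_nodes_view_of_succ hh (Or.inr hE)) hrs)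
      have hheard : ∀ h s, s < r → (h, s + 1) ∈ (view α m i).nodes →
          X.node r b = h ∨ α.pattern.Edge (s + 1) (X.node r b) h := by
        intro h s hsr hh
        by_contra hcon
        exact hhid.2 ⟨h, s, hsr, hh, fun he => hcon (eq_or_edge_of_mem_edges_view he)⟩
      have hedge : s < r → α.pattern.Edge (s + 1) (X.node r b) h := by
        intro hsr
        -- If `h` is the chain member itself, a missing message to itself would prove no crash; but
        -- `i` must have heard from it in round `s + 2`, so it was still active.
        rcases hheard h s hsr hh with rfl | hE
        · have hne : s + 1 ≠ r := by
            rintro rfl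
            exact hhid.1 hh
          rcases hheard i (s + 1) (by omega) (self_mem_nodes_view_of_le (by omega)) with he | hE
          · exact absurd he (Chains.node_ne hr)
          · exact hE.active.edge le_rfl
        · exact hE
      rw [Chains.edge_node hr]
      refine ⟨fun hE => Or.inl (hlt hE), ?_⟩
      rintro (hsr | hu | ⟨rfl, hh'⟩)
      · exact hedge hsr
      · rcases hr.lt_or_eq with hrm | rfl
        · rw [hρ r b (by omega)] at hu
          exact absurd hu (singleton_ne_univ hn _)
        · exact hedge hsm
      -- The one message added goes to the next chain member, which is hidden and so outside the set
      -- of seen nodes.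
      · rw [hρ s b (by omega)] at hh'
        obtain rfl : h = X.node (s + 1) b := hh'
        exact absurd hh (hX (s + 1) hsm b).1
  · exact fun j h s hh hE => mem_nodes_view_of_succ hh (Or.inr hE)

/-- A process that has decided in a solution that dominates `optMin` is low, or has a hidden
capacity smaller than `k`. -/
theorem low_or_hiddenCapacity_lt (hn : 2 ≤ n) (hkd : k ≤ d) {Q : Protocol.{u} n d}
    (hQ : Q.SolvesSetConsensus k (crashContext n d t))
    (hdom : Protocol.Dominates (crashContext n d t) Q (optMin n d k))
    (hα : α ∈ crashContext n d t) {y : Fin (d + 1)} (hdec : Q.DecidesAt α i m y) :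
    (view α m i).Low k ∨ (view α m i).hiddenCapacity m < k := by
  classical
  by_contra! hcon
  obtain ⟨hhigh, hcap⟩ := hcon
  obtain ⟨X, hX⟩ := exists_chains hcap
  -- Unseen inputs become `d ≥ k`, so that no low input is left.
  let v : Fin n → Fin (d + 1) := fun j =>
    if (j, 0) ∈ (view α m i).nodes then α.input j else Fin.last d
  have hv : ∀ j, k ≤ (v j : ℕ) := by
    intro j
    by_cases hj : (j, 0) ∈ (view α m i).nodes
    · simp only [v, if_pos hj]
      exact (not_lt.1 hhigh).trans
        (Fin.le_def.1 (View.minVal_le (mem_labels_view_iff.2 ⟨hj, rfl⟩)))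
    · simpa only [v, if_neg hj, Fin.val_last] using hkd
  let ρ := X.reachAt m fun _ => Set.univ
  have hρm : ∀ r, m ≤ r → ∀ b, ρ r b = Set.univ := by
    intro r hr b
    rcases hr.lt_or_eq with hr | rfl
    · exact Chains.reachAt_of_lt _ hr
    · exact Chains.reachAt_self _
  have hρ : X.IsChainBelow (m + 1) ρ := Chains.isChainBelow_reachAt _
  have hmem : ∀ S, X.adversary v hkd S ρ ∈ crashContext n d t := fun S =>
    Chains.adversary_mem hα hρm
  have h0 : Q.DecidesAt (X.adversary v hkd ∅ ρ) i m y :=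
    hdec.congr (Chains.correct_self.active m) fun s hs =>
      state_eq_adversary Q hkd hdec.1 hX (fun j hj => (if_pos hj).symm) hρ (hρm m le_rfl) hn hs
  -- Low inputs put on the chains do not reach `i` by time `m`, since each member before time `m`
  -- reaches only its successor.
  have h1 : Q.DecidesAt (X.adversary v hkd Set.univ ρ) i m y := by
    refine h0.congr (Chains.correct_self.active m) fun s hs => ?_
    refine Chains.state_eq Q hn le_rfl (hρ.mono (Nat.le_succ m)) (hρ.mono (Nat.le_succ m)) ∅
      (fun r b h => ?_) (fun b h => ?_) (by simp) (fun r b hr => ⟨Iff.rfl, fun h => ?_⟩) hs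
    · rw [X.pos_self] at h
      cases h
    · rw [X.pos_self] at h
      cases h
    · rw [hρ r b (by omega)] at h
      exact absurd h.symm (Chains.node_ne hr.le)
  have hlt := lt_of_decides_all hkd (hQ _ (hmem Set.univ)).1 (fun c => by
      obtain ⟨s, -, h⟩ := X.decidesAt_node hn hkd hQ hdom hα hv le_rfl (Set.mem_univ c) hρ hρm
      exact ⟨_, s, Chains.correct_node le_rfl (hρm m le_rfl c), h⟩)
    ⟨i, m, Chains.correct_self, h1⟩
  obtain ⟨j, hj⟩ := (hQ _ (hmem ∅)).2.2 i m y h0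
  rcases Chains.input_eq_or (X := X) (v := v) (hkd := hkd) (S := ∅) (ρ := ρ) (j := j) with
    h | ⟨b, hb, -⟩
  · rw [← hj, h] at hlt
    exact absurd hlt (not_lt.2 (hv j))
  · exact hb

end SetConsensus

theorem mainTheorem1 (n t k d : ℕ) (hn : 2 ≤ n) (ht : t ≤ n - 1) (hk : 1 ≤ k) (hkd : k ≤ d) :
    SetConsensus.Protocol.IsUnbeatable.{u, 0} k (SetConsensus.crashContext n d t)
      (SetConsensus.optMin n d k) := by
  refine ⟨SetConsensus.optMin_solvesSetConsensus hk _, fun Q hQ hdom => hdom.2 ?_⟩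
  intro α hα i m x hx
  exact SetConsensus.optMin_exists_decidesAt hx.1
    (SetConsensus.low_or_hiddenCapacity_lt hn hkd hQ hdom.1 hα hx)
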